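/- Let $A,B$ be finite-dimensional systems of dimensions $d_A,d_B\ge 1$, let $a,b$ be qubits, let $\Phi^+=|\phi_+\rangle\langle\phi_+|$ with $|\phi_+\rangle=\frac1{\sqrt d}\sum_{i=0}^{d-1}|ii\rangle$ denote the maximally entangled state (with $d=2$ on two qubits), and let $k\ge 0$ be an integer. A positive semidefinite operator $\rho_{PQ}$ is called $k$-extendible if there is a positive semidefinite operator $\rho_{PQ_0\ldots Q_k}$ all of whose marginals satisfy $\rho_{PQ_i}=\rho_{PQ}$, $i=0,\dots,k$. A completely positive (not necessarily trace-preserving) map $\Lambda$ from operators on $AB$ to operators on $ab$ is called $k$-extendible if its Choi–Jamiołkowski operator $(\mathrm{id}\otimes\Lambda)(\Phi^+_{A'A}\otimes\Phi^+_{B'B})$ is $k$-extendible with respect to the partition $P=A'a$, $Q=B'b$. For a state $\rho_{AB}$ with $\operatorname{tr}\Lambda(\rho)\neq0$ put $F(\rho,\Lambda)=\operatorname{tr}(\Lambda(\rho)\Phi^+)/\operatorname{tr}\Lambda(\rho)$. (i) For every $k\ge0$, the maximum of $F(\rho,\Lambda)$ over all $k$-extendible maps $\Lambda$ with $\operatorname{tr}\Lambda(\rho)\ne0$,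 for the maximally mixed state $\rho_{AB}=\frac1{d_A}I_A\otimes\frac1{d_B}I_B$, exists and equals $$F_{\max}(k)=\frac12\,\frac{k+2}{k+1}.$$ (ii) $F_{\max}(k)$ is also the maximum of $\operatorname{tr}(\sigma_{ab}\Phi^+)$ over all $k$-extendible two-qubit states $\sigma_{ab}$. (iii) In particular, for $k=1$ the maximum in (i) is $3/4$. Moreover, for every real $\alpha$, with $M=\alpha I-\Phi^+$ on two qubits and $e$ a third qubit, the set of eigenvalues of the operator $M_{ab}\otimes I_e+M_{ae}\otimes I_b$ is $$\Big\{2\alpha,\ \tfrac{4\alpha-3}{2},\ \tfrac{4\alpha-1}{2}\Big\};$$ this operator fails to be positive semidefinite if and only if $\alpha<3/4$, and this holds if and only if some $1$-extendible map $\Lambda$ satisfies $F(\rho,\Lambda)>\alpha$ for the maximally mixed state $\rho_{AB}$. -/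

import Mathlib

open scoped Kronecker ComplexOrder

noncomputable section

namespace ExtendibleMaps

/-- A qubit system: the computational basis is indexed by `Fin 2`, operators on a system with basis
`ι` are the matrices `Matrix ι ι ℂ`, and `ι × κ` indexes the tensor product of two systems. -/
abbrev Qubit : Type := Fin 2

/-- The maximally entangled unit vector `φ₊ = d^{-1/2} ∑ᵢ |i i⟩`, with `d` the dimension. -/
def phiPlus (ι : Type*) [Fintype ι] [DecidableEq ι] : ι × ι → ℂ :=
  fun p => if p.1 = p.2 then ((Real.sqrt (Fintype.card ι) : ℝ) : ℂ)⁻¹ else 0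

/-- The maximally entangled state `Φ⁺ = |φ₊⟩⟨φ₊|`. -/
def PhiPlus (ι : Type*) [Fintype ι] [DecidableEq ι] : Matrix (ι × ι) (ι × ι) ℂ :=
  Matrix.vecMulVec (phiPlus ι) (star (phiPlus ι))

/-- Density operators: positive semidefinite with trace one. -/
def IsState {ι : Type*} [Fintype ι] (ρ : Matrix ι ι ℂ) : Prop :=
  ρ.PosSemidef ∧ ρ.trace = 1

/-- The maximally mixed state `(I_A / d_A) ⊗ (I_B / d_B)`. -/
def maximallyMixed (A B : Type*) [Fintype A] [Fintype B] [DecidableEq A] [DecidableEq B] :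
    Matrix (A × B) (A × B) ℂ :=
  ((Fintype.card A : ℂ)⁻¹ • (1 : Matrix A A ℂ)) ⊗ₖ ((Fintype.card B : ℂ)⁻¹ • (1 : Matrix B B ℂ))

/-- The map `id ⊗ Λ` on operators on `R ⊗ ι`, where `R` is an ancillary system. -/
def idTensor {ι κ : Type*} (R : Type*) (Λ : Matrix ι ι ℂ →ₗ[ℂ] Matrix κ κ ℂ)
    (X : Matrix (R × ι) (R × ι) ℂ) : Matrix (R × κ) (R × κ) ℂ :=
  Matrix.of fun p q => Λ (Matrix.of fun i j => X (p.1, i) (q.1, j)) p.2 q.2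

/-- Complete positivity: `id_n ⊗ Λ` preserves positive semidefiniteness for every `n`. -/
def IsCompletelyPositive {ι κ : Type*} (Λ : Matrix ι ι ℂ →ₗ[ℂ] Matrix κ κ ℂ) : Prop :=
  ∀ (n : ℕ) (X : Matrix (Fin n × ι) (Fin n × ι) ℂ), X.PosSemidef →
    (idTensor (Fin n) Λ X).PosSemidef

/-- The marginal of an operator on `P ⊗ Q₀ ⊗ ⋯ ⊗ Q_k` on the systems `P` and `Q_i`:
the partial trace over all the `Q_j` with `j ≠ i`. -/
def marginal {P Q : Type*} [Fintype Q] {k : ℕ}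
    (τ : Matrix (P × (Fin (k + 1) → Q)) (P × (Fin (k + 1) → Q)) ℂ) (i : Fin (k + 1)) :
    Matrix (P × Q) (P × Q) ℂ :=
  Matrix.of fun x y => ∑ g : Fin k → Q,
    τ (x.1, i.insertNth (α := fun _ => Q) x.2 g) (y.1, i.insertNth (α := fun _ => Q) y.2 g)

/-- A (not necessarily normalized) bipartite operator `ρ` on `P ⊗ Q` is `k`-extendible (on the side
of `Q`) if there is a positive semidefinite operator on `P ⊗ Q₀ ⊗ ⋯ ⊗ Q_k` all of whose marginals
on `P ⊗ Q_i`, `0 ≤ i ≤ k`, are equal to `ρ`. If `ρ` has trace one, so has its extension. -/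
def IsExtendible {P Q : Type*} [Fintype Q] (k : ℕ) (ρ : Matrix (P × Q) (P × Q) ℂ) : Prop :=
  ∃ τ : Matrix (P × (Fin (k + 1) → Q)) (P × (Fin (k + 1) → Q)) ℂ,
    τ.PosSemidef ∧ ∀ i, marginal τ i = ρ

section Maps

variable {A B a b : Type*} [Fintype A] [Fintype B] [DecidableEq A] [DecidableEq B]

/-- The Choi–Jamiołkowski operator `(id ⊗ Λ)(Φ⁺_{A'A} ⊗ Φ⁺_{B'B})` of a map from operators on `AB`
to operators on `ab`; it acts on `(A'B')(ab)`, with `A' = A` and `B' = B`. -/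
def choi (Λ : Matrix (A × B) (A × B) ℂ →ₗ[ℂ] Matrix (a × b) (a × b) ℂ) :
    Matrix ((A × B) × (a × b)) ((A × B) × (a × b)) ℂ :=
  idTensor (A × B) Λ
    ((PhiPlus A ⊗ₖ PhiPlus B).submatrix
      (Equiv.prodProdProdComm A B A B) (Equiv.prodProdProdComm A B A B))

/-- A map is `k`-extendible if it is completely positive and its Choi–Jamiołkowski operator,
read as a bipartite operator for the partition `Aa | Bb`, is `k`-extendible (on Bob's side). -/
def IsExtendibleMap [Fintype b] (k : ℕ)
    (Λ : Matrix (A × B) (A × B) ℂ →ₗ[ℂ] Matrix (a × b) (a × b) ℂ) : Prop :=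
  IsCompletelyPositive Λ ∧
    IsExtendible k ((choi Λ).submatrix
      (Equiv.prodProdProdComm A a B b) (Equiv.prodProdProdComm A a B b))

/-- The fidelity `F(ρ, Λ) = tr (Λ(ρ) Φ⁺) / tr Λ(ρ)` for a map with two-qubit output. (For a
completely positive map and a state both traces are real.) -/
def fidelity (ρ : Matrix (A × B) (A × B) ℂ)
    (Λ : Matrix (A × B) (A × B) ℂ →ₗ[ℂ] Matrix (Qubit × Qubit) (Qubit × Qubit) ℂ) : ℝ :=
  (Λ ρ * PhiPlus Qubit).trace.re / (Λ ρ).trace.re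

/-- The fidelities obtainable (with nonzero probability) from `ρ` by `k`-extendible maps. -/
def mapFidelities (k : ℕ) (ρ : Matrix (A × B) (A × B) ℂ) : Set ℝ :=
  {F | ∃ Λ : Matrix (A × B) (A × B) ℂ →ₗ[ℂ] Matrix (Qubit × Qubit) (Qubit × Qubit) ℂ,
    IsExtendibleMap k Λ ∧ (Λ ρ).trace ≠ 0 ∧ F = fidelity ρ Λ}

end Maps

/-- The overlaps `tr (σ Φ⁺)` of the `k`-extendible two-qubit states `σ` with `Φ⁺`. -/
def stateFidelities (k : ℕ) : Set ℝ :=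
  {F | ∃ σ : Matrix (Qubit × Qubit) (Qubit × Qubit) ℂ,
    IsState σ ∧ IsExtendible k σ ∧ F = (σ * PhiPlus Qubit).trace.re}

/-- The operator `M^{(α)} = α I - Φ⁺` on two qubits. -/
def M (α : ℝ) : Matrix (Qubit × Qubit) (Qubit × Qubit) ℂ :=
  (α : ℂ) • 1 - PhiPlus Qubit

/-- The operator `M_{ab} ⊗ I_e + M_{ae} ⊗ I_b` on three qubits, with indices ordered `((a, b), e)`;
the second summand is the first one with the roles of `b` and `e` exchanged. -/
def symM (α : ℝ) :
    Matrix ((Qubit × Qubit) × Qubit) ((Qubit × Qubit) × Qubit) ℂ :=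
  M α ⊗ₖ (1 : Matrix Qubit Qubit ℂ) +
    (M α ⊗ₖ (1 : Matrix Qubit Qubit ℂ)).submatrix
      (fun p => ((p.1.1, p.2), p.1.2)) (fun p => ((p.1.1, p.2), p.1.2))

end ExtendibleMaps

end

/-! ### Marginals as sums over an inserted coordinate. -/

namespace ExtendibleMaps

/-! On the maximally mixed state, maps reduce to states. `Λ ρ` is the partial trace over `A'B'` of
the Choi operator, hence a `k`-extendible two-qubit operator
(`IsExtendibleMap.isExtendible_maximallyMixed`). Conversely, preparing a `k`-extendible state is a
`k`-extendible map (`isExtendibleMap_preparation`).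

For states the upper bound is monogamy: `∑ᵢ Φ⁺_{a bᵢ} ≤ (k + 2) / 2`, to be divided by the `k + 1`
equal marginals. Let `T` send `ψ` to its `k + 1` contractions, so that `T*T = 2 ∑ᵢ Φ⁺_{a bᵢ}`. A
weighted Cauchy–Schwarz count gives `‖T*u‖² ≤ (k + 2)‖u‖²` for `u = Tψ`, and hence `‖Tψ‖² ≤ (k +
2)‖ψ‖²`. The vector behind `optimalExtension` attains the bound.

For `k = 1`, `Φ⁺_{ab} + Φ⁺_{ae}` splits into two three-dimensional blocks, exchanged by flipping all
bits, and two null basis vectors. Its eigenvalues are `0, 1/2, 3/2`. -/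

theorem sum_insertNth {Q R : Type*} [Fintype Q] [AddCommMonoid R] {k : ℕ} (i : Fin (k + 1))
    (F : (Fin (k + 1) → Q) → R) :
    ∑ f, F f = ∑ c, ∑ g : Fin k → Q, F (i.insertNth (α := fun _ => Q) c g) := by
  rw [← Fintype.sum_prod_type', ← (Fin.insertNthEquiv (fun _ => Q) i).sum_comp]
  rfl

theorem marginal_apply {P Q : Type*} [Fintype Q] {k : ℕ}
    (τ : Matrix (P × (Fin (k + 1) → Q)) (P × (Fin (k + 1) → Q)) ℂ) (i : Fin (k + 1))
    (x y : P × Q) :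
    marginal τ i x y = ∑ g : Fin k → Q,
      τ (x.1, i.insertNth (α := fun _ => Q) x.2 g) (y.1, i.insertNth (α := fun _ => Q) y.2 g) :=
  rfl

theorem marginal_eq_sum_submatrix {P Q : Type*} [Fintype Q] {k : ℕ}
    (τ : Matrix (P × (Fin (k + 1) → Q)) (P × (Fin (k + 1) → Q)) ℂ) (i : Fin (k + 1)) :
    marginal τ i = ∑ g : Fin k → Q, τ.submatrix
      (fun x : P × Q => (x.1, i.insertNth (α := fun _ => Q) x.2 g))
      (fun x : P × Q => (x.1, i.insertNth (α := fun _ => Q) x.2 g)) := by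
  ext x y
  simp [marginal_apply, Matrix.sum_apply]

theorem marginal_posSemidef {P Q : Type*} [Fintype Q] {k : ℕ}
    {τ : Matrix (P × (Fin (k + 1) → Q)) (P × (Fin (k + 1) → Q)) ℂ} (hτ : τ.PosSemidef)
    (i : Fin (k + 1)) : (marginal τ i).PosSemidef := by
  rw [marginal_eq_sum_submatrix]
  exact Matrix.posSemidef_sum _ fun g _ => hτ.submatrix _

theorem trace_marginal {P Q : Type*} [Fintype P] [Fintype Q] {k : ℕ}
    (τ : Matrix (P × (Fin (k + 1) → Q)) (P × (Fin (k + 1) → Q)) ℂ) (i : Fin (k + 1)) :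
    (marginal τ i).trace = τ.trace := by
  simp only [Matrix.trace, Matrix.diag, marginal_apply, Fintype.sum_prod_type]
  exact Finset.sum_congr rfl fun p _ => (sum_insertNth i fun f => τ (p, f) (p, f)).symm

/-! ### The monogamy bound for overlaps with the maximally entangled state. -/

theorem PhiPlus_apply {ι : Type*} [Fintype ι] [DecidableEq ι] (p q : ι × ι) :
    PhiPlus ι p q = if p.1 = p.2 ∧ q.1 = q.2 then (Fintype.card ι : ℂ)⁻¹ else 0 := by
  have h : ((Real.sqrt (Fintype.card ι) : ℝ) : ℂ)⁻¹ * ((Real.sqrt (Fintype.card ι) : ℝ) : ℂ)⁻¹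
      = (Fintype.card ι : ℂ)⁻¹ := by
    rw [← mul_inv, ← Complex.ofReal_mul, Real.mul_self_sqrt (by positivity)]
    norm_num
  unfold PhiPlus phiPlus
  by_cases hp : p.1 = p.2 <;> by_cases hq : q.1 = q.2 <;>
    simp [Matrix.vecMulVec_apply, hp, hq, Complex.conj_ofReal, h]

theorem PhiPlus_qubit_apply (p q : Qubit × Qubit) :
    PhiPlus Qubit p q = if p.1 = p.2 ∧ q.1 = q.2 then 1 / 2 else 0 := by
  simp [PhiPlus_apply]

theorem trace_mul_PhiPlus (σ : Matrix (Qubit × Qubit) (Qubit × Qubit) ℂ) :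
    (σ * PhiPlus Qubit).trace = (1 / 2) * ∑ c, ∑ d, σ (c, c) (d, d) := by
  simp only [Matrix.trace, Matrix.diag, Matrix.mul_apply, Fintype.sum_prod_type,
    PhiPlus_qubit_apply, Fin.sum_univ_two]
  simp
  ring

/-- The contraction of `ψ` with the (unnormalized) maximally entangled vector of the first qubit
and the `i`-th of the other ones. -/
def contraction {k : ℕ} (ψ : Qubit × (Fin (k + 1) → Qubit) → ℂ) (i : Fin (k + 1))
    (g : Fin k → Qubit) : ℂ :=
  ∑ c, ψ (c, i.insertNth (α := fun _ => Qubit) c g)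

theorem card_filter_insertNth_eq {k : ℕ} (i : Fin (k + 1)) (g : Fin k → Qubit) (c d : Qubit) :
    (Finset.univ.filter fun j => i.insertNth (α := fun _ => Qubit) d g j = c).card
      = (if d = c then 1 else 0) + (Finset.univ.filter fun j => g j = c).card := by
  simp only [Finset.card_filter]
  rw [Fin.sum_univ_succAbove _ i]
  simp

/-- The inserted entry agrees with `c` for both values of `c`, contributing 2, and each entry of `g`
agrees with exactly one. This is the source of `k + 2`. -/
theorem sum_card_filter_insertNth_eq {k : ℕ} (i : Fin (k + 1)) (g : Fin k → Qubit) :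
    ∑ c, (Finset.univ.filter fun j => i.insertNth (α := fun _ => Qubit) c g j = c).card
      = k + 2 := by
  simp only [card_filter_insertNth_eq, if_true, Finset.sum_add_distrib]
  have h := Finset.card_eq_sum_card_fiberwise (f := g) (s := Finset.univ) (t := Finset.univ)
    (fun _ _ => Finset.mem_univ _)
  rw [← h]
  simp [add_comm]

/-- The adjoint of the contractions, applied to the family of all contractions of `ψ`. -/
def recombination {k : ℕ} (ψ : Qubit × (Fin (k + 1) → Qubit) → ℂ)
    (x : Qubit × (Fin (k + 1) → Qubit)) : ℂ :=
  ∑ i ∈ Finset.univ.filter (fun i => x.2 i = x.1), contraction ψ i (i.removeNth x.2)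

theorem sum_filter_insertNth {R : Type*} [AddCommMonoid R] {k : ℕ}
    (F : Fin (k + 1) → Qubit → (Fin (k + 1) → Qubit) → R) :
    ∑ c, ∑ f : Fin (k + 1) → Qubit, ∑ i ∈ Finset.univ.filter (fun i => f i = c), F i c f
      = ∑ i, ∑ g : Fin k → Qubit, ∑ c, F i c (i.insertNth (α := fun _ => Qubit) c g) := by
  simp only [Finset.sum_filter]
  rw [Finset.sum_comm_cycle]
  refine Finset.sum_congr rfl fun i _ => ?_
  conv_rhs => rw [Finset.sum_comm]
  refine Finset.sum_congr rfl fun c _ => ?_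
  rw [sum_insertNth i, Finset.sum_eq_single c]
  · simp
  · intro d _ hd
    simp [hd]
  · simp

/-- Cauchy–Schwarz at each basis vector costs the number of matching positions. After regrouping by
`(i, g)`, these numbers sum over `c` to `k + 2`. -/
theorem sum_norm_sq_recombination_le {k : ℕ} (ψ : Qubit × (Fin (k + 1) → Qubit) → ℂ) :
    ∑ x, ‖recombination ψ x‖ ^ 2 ≤ (k + 2) * ∑ i, ∑ g, ‖contraction ψ i g‖ ^ 2 := by
  have h : ∀ x : Qubit × (Fin (k + 1) → Qubit), ‖recombination ψ x‖ ^ 2 ≤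
      ∑ i ∈ Finset.univ.filter (fun i => x.2 i = x.1),
        ((Finset.univ.filter fun i => x.2 i = x.1).card : ℝ) *
          ‖contraction ψ i (i.removeNth x.2)‖ ^ 2 := by
    intro x
    rw [← Finset.mul_sum]
    refine le_trans ?_ sq_sum_le_card_mul_sum_sq
    gcongr
    exact norm_sum_le _ _
  refine (Finset.sum_le_sum fun x _ => h x).trans ?_
  rw [Fintype.sum_prod_type, sum_filter_insertNth fun i c f =>
    ((Finset.univ.filter fun i => f i = c).card : ℝ) * ‖contraction ψ i (i.removeNth f)‖ ^ 2]
  rw [Finset.mul_sum]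
  refine Finset.sum_le_sum fun i _ => ?_
  rw [Finset.mul_sum]
  refine Finset.sum_le_sum fun g _ => ?_
  simp only [Fin.removeNth_insertNth]
  rw [← Finset.sum_mul, ← Nat.cast_sum, sum_card_filter_insertNth_eq]
  push_cast
  rfl

/-- This is `‖Tψ‖² = ⟨T*Tψ, ψ⟩`, where `T` takes all contractions. -/
theorem sum_norm_sq_contraction_eq {k : ℕ} (ψ : Qubit × (Fin (k + 1) → Qubit) → ℂ) :
    ((∑ i, ∑ g, ‖contraction ψ i g‖ ^ 2 : ℝ) : ℂ) = ∑ x, star (recombination ψ x) * ψ x := by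
  rw [Fintype.sum_prod_type]
  simp only [recombination, star_sum, Finset.sum_mul]
  rw [sum_filter_insertNth fun i c f => star (contraction ψ i (i.removeNth f)) * ψ (c, f)]
  push_cast
  refine Finset.sum_congr rfl fun i _ => Finset.sum_congr rfl fun g _ => ?_
  simp only [Fin.removeNth_insertNth, ← Finset.mul_sum]
  exact (Complex.conj_mul' _).symm

theorem sum_norm_sq_contraction_le {k : ℕ} (ψ : Qubit × (Fin (k + 1) → Qubit) → ℂ) :
    ∑ i, ∑ g, ‖contraction ψ i g‖ ^ 2 ≤ (k + 2) * ∑ x, ‖ψ x‖ ^ 2 := by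
  set q := ∑ i, ∑ g, ‖contraction ψ i g‖ ^ 2 with hq
  have hq0 : 0 ≤ q := by positivity
  have h1 : q ≤ ∑ x, ‖recombination ψ x‖ * ‖ψ x‖ := by
    have h := norm_sum_le Finset.univ fun x => star (recombination ψ x) * ψ x
    rw [← sum_norm_sq_contraction_eq, ← hq, Complex.norm_real, Real.norm_of_nonneg hq0] at h
    simpa using h
  have h2 := sum_norm_sq_recombination_le ψ
  rw [← hq] at h2
  have h3 : (∑ x, ‖recombination ψ x‖ * ‖ψ x‖) ^ 2 ≤
      (∑ x, ‖recombination ψ x‖ ^ 2) * ∑ x, ‖ψ x‖ ^ 2 := Finset.sum_mul_sq_le_sq_mul_sq _ _ _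
  -- The bound on `T*Tψ` is again in terms of `q`, so one factor `q` cancels.
  have h4 : q ^ 2 ≤ (k + 2) * q * ∑ x, ‖ψ x‖ ^ 2 :=
    (pow_le_pow_left₀ hq0 h1 2).trans <| h3.trans <| by gcongr
  rcases hq0.eq_or_lt with h0 | h0
  · rw [← h0]; positivity
  · refine le_of_mul_le_mul_left (a := q) ?_ h0
    linarith [h4]

/-- Monogamy: the overlaps of the marginals of `τ` with `Φ⁺`, summed over the marginals. -/
theorem sum_trace_marginal_mul_PhiPlus_le {k : ℕ}
    {τ : Matrix (Qubit × (Fin (k + 1) → Qubit)) (Qubit × (Fin (k + 1) → Qubit)) ℂ}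
    (hτ : τ.PosSemidef) :
    ∑ i, (marginal τ i * PhiPlus Qubit).trace.re ≤ (k + 2) / 2 * τ.trace.re := by
  -- Both sides are linear in `τ`, so rank-one terms suffice.
  obtain ⟨m, v, rfl⟩ := Matrix.posSemidef_iff_eq_sum_vecMulVec.mp hτ
  set τ := ∑ z, Matrix.vecMulVec (v z) (star (v z)) with hτ_def
  have h0 : ∀ x y, τ x y = ∑ z, v z x * star (v z y) := fun x y => by
    simp [hτ_def, Matrix.sum_apply, Matrix.vecMulVec_apply]
  have h1 : ∀ i, (marginal τ i * PhiPlus Qubit).trace.re =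
      1 / 2 * ∑ z, ∑ g, ‖contraction (v z) i g‖ ^ 2 := by
    intro i
    have : (marginal τ i * PhiPlus Qubit).trace =
        ((1 / 2 * ∑ z, ∑ g, ‖contraction (v z) i g‖ ^ 2 : ℝ) : ℂ) := by
      rw [trace_mul_PhiPlus]
      push_cast
      simp only [← Complex.mul_conj', contraction, map_sum, Finset.sum_mul_sum, marginal_apply, h0]
      congr 1
      simp_rw [Finset.sum_comm (s := Finset.univ (α := Fin k → Qubit))
        (t := Finset.univ (α := Fin m))]
      rw [Finset.sum_comm_cycle]
      refine Finset.sum_congr rfl fun z _ => ?_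
      rw [Finset.sum_comm_cycle]
      rfl
    rw [this, Complex.ofReal_re]
  have h2 : τ.trace.re = ∑ z, ∑ x, ‖v z x‖ ^ 2 := by
    have : τ.trace = ((∑ z, ∑ x, ‖v z x‖ ^ 2 : ℝ) : ℂ) := by
      push_cast
      rw [Finset.sum_comm]
      simp only [← Complex.mul_conj', Matrix.trace, Matrix.diag, h0]
      rfl
    rw [this, Complex.ofReal_re]
  simp only [h1, h2, ← Finset.mul_sum]
  rw [Finset.sum_comm]
  have := Finset.sum_le_sum fun z (_ : z ∈ Finset.univ) => sum_norm_sq_contraction_le (v z)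
  rw [← Finset.mul_sum] at this
  linarith

theorem IsExtendible.trace_mul_PhiPlus_le {k : ℕ}
    {σ : Matrix (Qubit × Qubit) (Qubit × Qubit) ℂ} (hσ : IsExtendible k σ) :
    (σ * PhiPlus Qubit).trace.re ≤ 1 / 2 * (((k : ℝ) + 2) / ((k : ℝ) + 1)) * σ.trace.re := by
  obtain ⟨τ, hτ, h⟩ := hσ
  have h1 := sum_trace_marginal_mul_PhiPlus_le hτ
  simp only [h, Finset.sum_const, Finset.card_univ, Fintype.card_fin, nsmul_eq_mul] at h1
  rw [← trace_marginal τ 0, h] at h1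
  push_cast at h1
  have hk : (0 : ℝ) < k + 1 := by positivity
  rw [← mul_le_mul_iff_right₀ hk]
  refine h1.trans (le_of_eq ?_)
  field_simp

/-! ### Reduction of extendible maps to extendible states. -/

theorem insertNth_prodMk {B b : Type*} {k : ℕ} (i : Fin (k + 1)) (y : B) (t : b)
    (h : Fin k → B) (g : Fin k → b) :
    i.insertNth (α := fun _ => B × b) (y, t) (fun j => (h j, g j)) =
      fun j => (i.insertNth (α := fun _ => B) y h j, i.insertNth (α := fun _ => b) t g j) := by
  funext j
  refine i.succAboveCases ?_ (fun j => ?_) j <;> simp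

theorem sum_arrow_prod {ι B b R : Type*} [Fintype ι] [DecidableEq ι] [Fintype B] [Fintype b]
    [AddCommMonoid R] (F : (ι → B × b) → R) :
    ∑ G, F G = ∑ h : ι → B, ∑ g : ι → b, F fun j => (h j, g j) := by
  rw [← Fintype.sum_prod_type',
    ← (Equiv.arrowProdEquivProdArrow ι (fun _ => B) fun _ => b).symm.sum_comp]
  rfl

theorem IsExtendible.posSemidef {P Q : Type*} [Fintype Q] {k : ℕ}
    {ρ : Matrix (P × Q) (P × Q) ℂ} (h : IsExtendible k ρ) : ρ.PosSemidef := by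
  obtain ⟨τ, hτ, h⟩ := h
  rw [← h 0]
  exact marginal_posSemidef hτ 0

/-- Extendibility is preserved by the local partial traces over `A` and `B`. -/
theorem IsExtendible.partialTrace {A B a b : Type*} [Fintype A] [Fintype B] [Fintype b] {k : ℕ}
    {ω : Matrix ((A × a) × (B × b)) ((A × a) × (B × b)) ℂ} (hω : IsExtendible k ω) :
    IsExtendible k (Matrix.of fun p q : a × b =>
      ∑ x : A, ∑ y : B, ω ((x, p.1), (y, p.2)) ((x, q.1), (y, q.2))) := by
  obtain ⟨τ, hτ, h⟩ := hω
  let e (x : A) (f : Fin (k + 1) → B) (p : a × (Fin (k + 1) → b)) :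
      (A × a) × (Fin (k + 1) → B × b) := ((x, p.1), fun j => (f j, p.2 j))
  refine ⟨∑ x, ∑ f, τ.submatrix (e x f) (e x f), Matrix.posSemidef_sum _ fun x _ =>
    Matrix.posSemidef_sum _ fun f _ => hτ.submatrix _, fun i => ?_⟩
  ext ⟨s, t⟩ ⟨s', t'⟩
  simp only [marginal_apply, Matrix.of_apply, Matrix.sum_apply, Matrix.submatrix_apply, e, ← h i]
  rw [Finset.sum_comm]
  refine Finset.sum_congr rfl fun x _ => ?_
  rw [Finset.sum_comm, sum_insertNth i]
  refine Finset.sum_congr rfl fun y _ => ?_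
  rw [sum_arrow_prod]
  simp only [insertNth_prodMk]

section Maps

variable {A B a b : Type*} [Fintype A] [Fintype B]

/-- The map that discards its input and prepares `σ`. -/
noncomputable def preparation (σ : Matrix (a × b) (a × b) ℂ) :
    Matrix (A × B) (A × B) ℂ →ₗ[ℂ] Matrix (a × b) (a × b) ℂ :=
  (Matrix.traceLinearMap (A × B) ℂ ℂ).smulRight σ

theorem preparation_apply (σ : Matrix (a × b) (a × b) ℂ) (X : Matrix (A × B) (A × B) ℂ) :
    preparation σ X = X.trace • σ :=
  rfl

theorem isCompletelyPositive_preparation [Finite a] [Finite b] {σ : Matrix (a × b) (a × b) ℂ}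
    (hσ : σ.PosSemidef) : IsCompletelyPositive (preparation (A := A) (B := B) σ) := by
  intro n X hX
  have h : idTensor (Fin n) (preparation σ) X =
      (∑ i, X.submatrix (fun r => (r, i)) (fun r => (r, i))) ⊗ₖ σ := by
    ext p q
    simp [idTensor, preparation_apply, Matrix.trace, Matrix.sum_apply]
  rw [h]
  exact (Matrix.posSemidef_sum _ fun i _ => hX.submatrix _).kronecker hσ

variable [DecidableEq A] [DecidableEq B]

theorem choi_apply (Λ : Matrix (A × B) (A × B) ℂ →ₗ[ℂ] Matrix (a × b) (a × b) ℂ)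
    (x x' : A) (y y' : B) (p q : a × b) :
    choi Λ ((x, y), p) ((x', y'), q) =
      ((Fintype.card A : ℂ)⁻¹ * (Fintype.card B : ℂ)⁻¹) *
        Λ (Matrix.single (x, y) (x', y') 1) p q := by
  rw [← smul_eq_mul, ← Matrix.smul_apply, ← map_smul]
  unfold choi idTensor
  simp only [Matrix.of_apply]
  refine congrFun (congrFun (congrArg Λ ?_) p) q
  ext ⟨i, j⟩ ⟨i', j'⟩
  simp only [Matrix.submatrix_apply, Matrix.kroneckerMap_apply, Equiv.prodProdProdComm_apply,
    PhiPlus_apply, Matrix.of_apply, Matrix.smul_apply, Matrix.single_apply, Prod.mk.injEq]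
  by_cases h1 : x = i <;> by_cases h2 : y = j <;> by_cases h3 : x' = i' <;>
    by_cases h4 : y' = j' <;> simp [h1, h2, h3, h4]

theorem maximallyMixed_eq : maximallyMixed A B =
    ((Fintype.card A : ℂ)⁻¹ * (Fintype.card B : ℂ)⁻¹) • (1 : Matrix (A × B) (A × B) ℂ) := by
  rw [maximallyMixed, Matrix.smul_kronecker, Matrix.kronecker_smul, Matrix.one_kronecker_one,
    smul_smul]

theorem trace_maximallyMixed [Nonempty A] [Nonempty B] : (maximallyMixed A B).trace = 1 := by
  rw [maximallyMixed_eq, Matrix.trace_smul, Matrix.trace_one, Fintype.card_prod]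
  have hA : (Fintype.card A : ℂ) ≠ 0 := by simp
  have hB : (Fintype.card B : ℂ) ≠ 0 := by simp
  simp only [smul_eq_mul]
  push_cast
  field_simp

/-- Tracing `A'B'` out of the Choi operator sums `Λ` over the diagonal matrix units with weight `1 /
(d_A d_B)`, which is `Λ` of the maximally mixed state. -/
theorem IsExtendibleMap.isExtendible_maximallyMixed [Fintype b] {k : ℕ}
    {Λ : Matrix (A × B) (A × B) ℂ →ₗ[ℂ] Matrix (a × b) (a × b) ℂ} (hΛ : IsExtendibleMap k Λ) :
    IsExtendible k (Λ (maximallyMixed A B)) := by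
  convert hΛ.2.partialTrace using 1
  ext p q
  simp only [Matrix.of_apply, Matrix.submatrix_apply, Equiv.prodProdProdComm_apply, choi_apply,
    ← Finset.mul_sum, maximallyMixed_eq, map_smul, Matrix.smul_apply, smul_eq_mul]
  congr 1
  have h : (1 : Matrix (A × B) (A × B) ℂ) = ∑ x, ∑ y, Matrix.single (x, y) (x, y) 1 := by
    rw [← Fintype.sum_prod_type' (f := fun x y => Matrix.single (x, y) (x, y) (1 : ℂ))]
    exact Matrix.sum_single_one.symm
  simp only [h, map_sum, Matrix.sum_apply]

/-- The Choi operator is the maximally mixed state tensored with `σ`; extend the two factors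
separately. -/
theorem isExtendibleMap_preparation [Nonempty B] [Finite a] [Fintype b] {k : ℕ}
    {σ : Matrix (a × b) (a × b) ℂ} (hσ : IsExtendible k σ) :
    IsExtendibleMap k (preparation (A := A) (B := B) σ) := by
  refine ⟨isCompletelyPositive_preparation hσ.posSemidef, ?_⟩
  obtain ⟨τ, hτ, h⟩ := hσ
  let e (p : (A × a) × (Fin (k + 1) → B × b)) :
      (A × (Fin (k + 1) → B)) × (a × (Fin (k + 1) → b)) :=
    ((p.1.1, fun j => (p.2 j).1), (p.1.2, fun j => (p.2 j).2))
  -- Each marginal traces out `k` copies of `B`, and the resulting `d_B ^ k` leaves the Choi weight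
  -- `1 / (d_A d_B)`.
  let c : ℝ := (Fintype.card A : ℝ)⁻¹ * (Fintype.card B : ℝ)⁻¹ ^ (k + 1)
  have hc : 0 ≤ c := by positivity
  refine ⟨(c : ℂ) • ((1 : Matrix (A × (Fin (k + 1) → B)) (A × (Fin (k + 1) → B)) ℂ) ⊗ₖ τ).submatrix
    e e, ((Matrix.PosSemidef.one.kronecker hτ).submatrix _).smul (by exact_mod_cast hc),
    fun i => ?_⟩
  ext ⟨⟨x, s⟩, y, t⟩ ⟨⟨x', s'⟩, y', t'⟩
  have hB : (Fintype.card B : ℂ) ≠ 0 := by simp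
  simp only [marginal_apply, Matrix.submatrix_apply, Equiv.prodProdProdComm_apply, choi_apply,
    preparation_apply, ← h i, Matrix.smul_apply, smul_eq_mul, Matrix.kroneckerMap_apply, e]
  rw [sum_arrow_prod]
  simp only [insertNth_prodMk, Matrix.one_apply, Prod.mk.injEq]
  by_cases hx : x = x' <;> by_cases hy : y = y'
  · subst hx hy
    simp only [true_and, if_true, one_mul, ← Finset.mul_sum, Finset.sum_const, Finset.card_univ,
      Fintype.card_fun, Fintype.card_fin, nsmul_eq_mul, Matrix.trace_single_eq_same, c]
    push_cast
    rw [inv_pow]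
    field_simp
    ring
  · simp [hx, hy, Fin.insertNth_inj]
  · simp [hx, hy]
  · simp [hx, hy]

theorem mem_upperBounds_mapFidelities_maximallyMixed (k : ℕ) :
    (1 / 2 : ℝ) * (((k : ℝ) + 2) / ((k : ℝ) + 1)) ∈
      upperBounds (mapFidelities k (maximallyMixed A B)) := by
  rintro F ⟨Λ, hΛ, h0, rfl⟩
  have h := hΛ.isExtendible_maximallyMixed
  have htr := h.posSemidef.trace_nonneg
  have hpos : 0 < (Λ (maximallyMixed A B)).trace.re :=
    (Complex.pos_iff.mp (lt_of_le_of_ne htr h0.symm)).1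
  exact (div_le_iff₀ hpos).mpr h.trace_mul_PhiPlus_le

theorem stateFidelities_subset_mapFidelities [Nonempty A] [Nonempty B] (k : ℕ) :
    stateFidelities k ⊆ mapFidelities k (maximallyMixed A B) := by
  rintro F ⟨σ, ⟨-, htr⟩, hext, rfl⟩
  have h : preparation σ (maximallyMixed A B) = σ := by
    rw [preparation_apply, trace_maximallyMixed, one_smul]
  refine ⟨preparation σ, isExtendibleMap_preparation hext, by simp [h, htr], ?_⟩
  simp [fidelity, h, htr]

end Maps

theorem mem_upperBounds_stateFidelities (k : ℕ) :
    (1 / 2 : ℝ) * (((k : ℝ) + 2) / ((k : ℝ) + 1)) ∈ upperBounds (stateFidelities k) := by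
  rintro F ⟨σ, ⟨-, htr⟩, hext, rfl⟩
  simpa [htr] using hext.trace_mul_PhiPlus_le

/-! ### An optimal extendible state. -/

theorem sum_val_eq_zero_count (k : ℕ) :
    ∑ g : Fin k → Qubit, (if ∑ j, (g j).val = 0 then (1 : ℂ) else 0) = 1 := by
  rw [Finset.sum_eq_single 0]
  · simp
  · intro g _ hg
    rw [if_neg]
    contrapose! hg
    funext j
    exact Fin.ext (by simpa using Finset.sum_eq_zero_iff.mp hg j)
  · simp

theorem sum_val_eq_one_count (k : ℕ) :
    ∑ g : Fin k → Qubit, (if ∑ j, (g j).val = 1 then (1 : ℂ) else 0) = k := by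
  induction k with
  | zero => simp
  | succ k ih =>
    rw [sum_insertNth 0, Fin.sum_univ_two]
    simp only [Fin.sum_univ_succ, Fin.insertNth_zero', Fin.cons_zero, Fin.cons_succ]
    simp only [Fin.val_zero, Fin.val_one, zero_add, Nat.add_eq_left, ih, sum_val_eq_zero_count]
    push_cast
    rfl

/-- The amplitude of an optimal vector in terms of the first qubit and the Hamming weight of the
other ones: it is proportional to `(k + 1)|0⟩|0…0⟩ + |1⟩ ∑ⱼ |0…1ⱼ…0⟩`. -/
noncomputable def amplitude (k : ℕ) (c : Qubit) (w : ℕ) : ℂ :=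
  if c = 0 then (if w = 0 then (k : ℂ) + 1 else 0) else if w = 1 then 1 else 0

/-- A `k`-extension of an optimal state. -/
noncomputable def optimalExtension (k : ℕ) :
    Matrix (Qubit × (Fin (k + 1) → Qubit)) (Qubit × (Fin (k + 1) → Qubit)) ℂ :=
  ((((k + 1) * (k + 2) : ℝ)⁻¹ : ℝ) : ℂ) •
    Matrix.vecMulVec (fun x => amplitude k x.1 (∑ j, (x.2 j).val))
      (star fun x => amplitude k x.1 (∑ j, (x.2 j).val))

theorem optimalExtension_posSemidef (k : ℕ) : (optimalExtension k).PosSemidef :=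
  (Matrix.posSemidef_vecMulVec_self_star _).smul
    (Complex.zero_le_real.mpr (by positivity))

/-- The amplitude sees only the Hamming weight, so the right side is independent of `i`: all
marginals agree. -/
theorem marginal_optimalExtension_apply (k : ℕ) (i : Fin (k + 1)) (x y : Qubit × Qubit) :
    marginal (optimalExtension k) i x y = ((k + 1) * (k + 2) : ℂ)⁻¹ *
      ∑ g : Fin k → Qubit, amplitude k x.1 (x.2.val + ∑ j, (g j).val) *
        amplitude k y.1 (y.2.val + ∑ j, (g j).val) := by
  have hreal : ∀ c w, star (amplitude k c w) = amplitude k c w := by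
    intro c w
    unfold amplitude
    split_ifs <;> simp
  simp only [marginal_apply, optimalExtension, Matrix.smul_apply, Matrix.vecMulVec_apply,
    Pi.star_apply, Fin.sum_univ_succAbove _ i, Fin.insertNth_apply_same,
    Fin.insertNth_apply_succAbove, hreal, smul_eq_mul, Finset.mul_sum]
  push_cast
  rfl

theorem trace_marginal_optimalExtension (k : ℕ) (i : Fin (k + 1)) :
    (marginal (optimalExtension k) i).trace = 1 := by
  -- Only traced-out strings of weight 0 and 1 contribute; there are 1 and `k` of them, giving
  -- squared norm `(k + 1)² + 1 + k = (k + 1)(k + 2)`.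
  have h : ∀ w : ℕ, amplitude k 0 w * amplitude k 0 w +
      amplitude k 0 (1 + w) * amplitude k 0 (1 + w) +
      (amplitude k 1 w * amplitude k 1 w +
      amplitude k 1 (1 + w) * amplitude k 1 (1 + w)) =
      ((k + 1) * (k + 1) + 1) * (if w = 0 then 1 else 0) + (if w = 1 then 1 else 0) := by
    intro w
    by_cases h0 : w = 0
    · simp [amplitude, h0]
    · by_cases h1 : w = 1 <;> simp [amplitude, h0, h1]
  simp only [Matrix.trace, Matrix.diag, marginal_optimalExtension_apply, ← Finset.mul_sum,
    Fintype.sum_prod_type, Fin.sum_univ_two, ← Finset.sum_add_distrib, Fin.val_zero,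
    Fin.val_one, zero_add, h]
  rw [Finset.sum_add_distrib, ← Finset.mul_sum, sum_val_eq_zero_count, sum_val_eq_one_count]
  have h1 : (k : ℂ) + 1 ≠ 0 := by exact_mod_cast k.succ_ne_zero
  have h2 : (k : ℂ) + 2 ≠ 0 := by exact_mod_cast (k + 1).succ_ne_zero
  field_simp
  ring

theorem trace_marginal_optimalExtension_mul_PhiPlus (k : ℕ) (i : Fin (k + 1)) :
    (marginal (optimalExtension k) i * PhiPlus Qubit).trace =
      1 / 2 * ((k + 2) / (k + 1)) := by
  -- The contraction vanishes unless the remaining qubits are all 0, where it equals `(k + 1) + 1`.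
  have h : ∀ w : ℕ, amplitude k 0 w * (amplitude k 0 w + amplitude k 1 (1 + w)) +
      amplitude k 1 (1 + w) * (amplitude k 0 w + amplitude k 1 (1 + w)) =
      ((k + 2) * (k + 2)) * (if w = 0 then 1 else 0) := by
    intro w
    by_cases h0 : w = 0
    · simp [amplitude, h0]
      ring
    · simp [amplitude, h0]
  simp only [trace_mul_PhiPlus, marginal_optimalExtension_apply, ← Finset.mul_sum,
    Fin.sum_univ_two, ← mul_add, ← Finset.sum_add_distrib, Fin.val_zero,
    Fin.val_one, zero_add, h]
  rw [sum_val_eq_zero_count]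
  have h1 : (k : ℂ) + 1 ≠ 0 := by exact_mod_cast k.succ_ne_zero
  have h2 : (k : ℂ) + 2 ≠ 0 := by exact_mod_cast (k + 1).succ_ne_zero
  field_simp

theorem mem_stateFidelities (k : ℕ) :
    (1 / 2 : ℝ) * (((k : ℝ) + 2) / ((k : ℝ) + 1)) ∈ stateFidelities k := by
  refine ⟨marginal (optimalExtension k) 0, ⟨marginal_posSemidef (optimalExtension_posSemidef k) 0,
    trace_marginal_optimalExtension k 0⟩, ⟨_, optimalExtension_posSemidef k, fun i => ?_⟩, ?_⟩
  · ext x y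
    simp only [marginal_optimalExtension_apply]
  · rw [trace_marginal_optimalExtension_mul_PhiPlus]
    rw [← Complex.ofReal_re ((1 / 2 : ℝ) * (((k : ℝ) + 2) / ((k : ℝ) + 1)))]
    push_cast
    rfl

theorem isGreatest_stateFidelities (k : ℕ) :
    IsGreatest (stateFidelities k) ((1 / 2 : ℝ) * (((k : ℝ) + 2) / ((k : ℝ) + 1))) :=
  ⟨mem_stateFidelities k, mem_upperBounds_stateFidelities k⟩

theorem isGreatest_mapFidelities_maximallyMixed (A B : Type*) [Fintype A] [Fintype B]
    [DecidableEq A] [DecidableEq B] [Nonempty A] [Nonempty B] (k : ℕ) :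
    IsGreatest (mapFidelities k (maximallyMixed A B))
      ((1 / 2 : ℝ) * (((k : ℝ) + 2) / ((k : ℝ) + 1))) :=
  ⟨stateFidelities_subset_mapFidelities k (mem_stateFidelities k),
    mem_upperBounds_mapFidelities_maximallyMixed k⟩

/-! ### The spectrum of the three-qubit operator. -/

theorem symM_mulVec (α : ℝ) (v : (Qubit × Qubit) × Qubit → ℂ) (a b e : Qubit) :
    (symM α).mulVec v ((a, b), e) = 2 * α * v ((a, b), e) -
      (if a = b then (v ((0, 0), e) + v ((1, 1), e)) / 2 else 0) -
      (if a = e then (v ((0, b), 0) + v ((1, b), 1)) / 2 else 0) := by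
  simp only [Matrix.mulVec, dotProduct, symM, M, Fintype.sum_prod_type, Fin.sum_univ_two,
    Matrix.add_apply, Matrix.sub_apply, Matrix.smul_apply, Matrix.kroneckerMap_apply,
    Matrix.submatrix_apply, Matrix.one_apply, PhiPlus_qubit_apply]
  fin_cases a <;> fin_cases b <;> fin_cases e <;> simp <;> first | ring1 | (left; ring1)

theorem symM_isHermitian (α : ℝ) : (symM α).IsHermitian := by
  have hM : (M α).IsHermitian := by
    ext p q
    simp only [M, Matrix.conjTranspose_apply, Matrix.sub_apply, Matrix.smul_apply,
      Matrix.one_apply, PhiPlus_qubit_apply, and_comm (a := q.1 = q.2), eq_comm (a := q)]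
    split_ifs <;> simp [Complex.conj_ofReal]
  have h : (M α ⊗ₖ (1 : Matrix Qubit Qubit ℂ)).IsHermitian := by
    rw [Matrix.IsHermitian, Matrix.conjTranspose_kronecker, hM.eq, Matrix.conjTranspose_one]
  exact h.add (h.submatrix _)

theorem mem_spectrum_iff_exists_mulVec {ι : Type*} [Fintype ι] [DecidableEq ι]
    (X : Matrix ι ι ℂ) (μ : ℂ) : μ ∈ spectrum ℂ X ↔ ∃ v, v ≠ 0 ∧ X.mulVec v = μ • v := by
  rw [← Matrix.spectrum_toLin', ← Module.End.hasEigenvalue_iff_mem_spectrum]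
  constructor
  · intro h
    obtain ⟨v, hv⟩ := h.exists_hasEigenvector
    exact ⟨v, hv.2, by simpa using hv.apply_eq_smul⟩
  · rintro ⟨v, hv, h⟩
    exact Module.End.hasEigenvalue_of_hasEigenvector
      (x := v) (Module.End.hasEigenvector_iff.mpr
        ⟨Module.End.mem_eigenspace_iff.mpr (by simpa), hv⟩)

/-- The equations say that `(x, y, z)` is an `l`-eigenvector of `Φ⁺_{ab} + Φ⁺_{ae}` on the span of
`|000⟩, |110⟩, |101⟩`. Excluding `1/2` forces `y = z`, excluding `0` forces `x = 2y`, and excluding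
`3/2` forces `y = 0`. -/
theorem eq_zero_of_sector {l x y z : ℂ} (h0 : l ≠ 0) (h1 : l ≠ 3 / 2) (h2 : l ≠ 1 / 2)
    (hx : (x + y) / 2 + (x + z) / 2 = l * x) (hy : (x + y) / 2 = l * y)
    (hz : (x + z) / 2 = l * z) : x = 0 ∧ y = 0 ∧ z = 0 := by
  have hyz : y = z := by
    refine mul_left_cancel₀ (sub_ne_zero.mpr h2) ?_
    linear_combination hz - hy
  subst hyz
  have hxy : x = 2 * y := by
    refine mul_left_cancel₀ h0 ?_
    linear_combination 2 * hy - hx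
  have hy0 : y = 0 := by
    refine mul_left_cancel₀ (sub_ne_zero.mpr h1) ?_
    rw [hxy] at hy
    linear_combination -hy
  simp [hxy, hy0]

theorem spectrum_symM (α : ℝ) : spectrum ℂ (symM α) =
    {2 * (α : ℂ), (4 * (α : ℂ) - 3) / 2, (4 * (α : ℂ) - 1) / 2} := by
  ext μ
  rw [mem_spectrum_iff_exists_mulVec, Set.mem_insert_iff, Set.mem_insert_iff,
    Set.mem_singleton_iff]
  constructor
  · rintro ⟨v, hv, h⟩
    by_contra! hμ
    obtain ⟨h1, h2, h3⟩ := hμ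
    have H : ∀ a b e : Qubit, (if a = b then (v ((0, 0), e) + v ((1, 1), e)) / 2 else 0) +
      (if a = e then (v ((0, b), 0) + v ((1, b), 1)) / 2 else 0) =
      (2 * α - μ) * v ((a, b), e) := by
      intro a b e
      have := congrFun h ((a, b), e)
      rw [symM_mulVec, Pi.smul_apply, smul_eq_mul] at this
      linear_combination -this
    have l0 : 2 * (α : ℂ) - μ ≠ 0 := sub_ne_zero.mpr h1.symm
    have l1 : 2 * (α : ℂ) - μ ≠ 3 / 2 := fun h => h2 (by linear_combination -h)
    have l2 : 2 * (α : ℂ) - μ ≠ 1 / 2 := fun h => h3 (by linear_combination -h)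
    obtain ⟨z000, z110, z101⟩ := eq_zero_of_sector l0 l1 l2 (x := v ((0, 0), 0))
      (y := v ((1, 1), 0)) (z := v ((1, 0), 1))
      (by simpa using H 0 0 0) (by simpa using H 1 1 0) (by simpa using H 1 0 1)
    -- The second block is the first with every bit flipped.
    obtain ⟨z111, z001, z010⟩ := eq_zero_of_sector l0 l1 l2 (x := v ((1, 1), 1))
      (y := v ((0, 0), 1)) (z := v ((0, 1), 0))
      (by simpa [add_comm] using H 1 1 1) (by simpa [add_comm] using H 0 0 1)
      (by simpa [add_comm] using H 0 1 0)
    have z011 : v ((0, 1), 1) = 0 := by simpa [l0] using H 0 1 1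
    have z100 : v ((1, 0), 0) = 0 := by simpa [l0] using H 1 0 0
    apply hv
    funext ⟨⟨a, b⟩, e⟩
    fin_cases a <;> fin_cases b <;> fin_cases e <;> assumption
  · have key : ∀ x y z w : ℂ,
        (fun p : (Qubit × Qubit) × Qubit => if p = ((0, 0), 0) then x else
          if p = ((1, 1), 0) then y else if p = ((1, 0), 1) then z else
          if p = ((1, 0), 0) then w else 0) ≠ 0 →
        (x + y) / 2 + (x + z) / 2 = (2 * α - μ) * x → (x + y) / 2 = (2 * α - μ) * y →
        (x + z) / 2 = (2 * α - μ) * z → 2 * α = μ ∨ w = 0 →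
        ∃ v, v ≠ 0 ∧ (symM α).mulVec v = μ • v := by
      intro x y z w hv hx hy hz hw
      refine ⟨_, hv, ?_⟩
      funext ⟨⟨a, b⟩, e⟩
      rw [symM_mulVec]
      fin_cases a <;> fin_cases b <;> fin_cases e <;> simp <;>
        first
        | linear_combination -hx
        | linear_combination -hy
        | linear_combination -hz
        | exact hw
    rintro (rfl | rfl | rfl)
    -- The three eigenvectors are `|100⟩`, `2|000⟩ + |110⟩ + |101⟩` and `|110⟩ - |101⟩`.
    · refine key 0 0 0 1 (fun h => ?_) (by ring) (by ring) (by ring) (.inl rfl)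
      simpa using congrFun h ((1, 0), 0)
    · refine key 2 1 1 0 (fun h => ?_) (by ring) (by ring) (by ring) (.inr rfl)
      simpa using congrFun h ((0, 0), 0)
    · refine key 0 1 (-1) 0 (fun h => ?_) (by ring) (by ring) (by ring) (.inr rfl)
      simpa using congrFun h ((1, 1), 0)

theorem symM_posSemidef_iff (α : ℝ) : (symM α).PosSemidef ↔ 3 / 4 ≤ α := by
  rw [Matrix.posSemidef_iff_isHermitian_and_spectrum_nonneg, spectrum_symM,
    and_iff_right (symM_isHermitian α)]
  simp only [Set.insert_subset_iff, Set.singleton_subset_iff, Set.mem_ofPred_eq]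
  have e1 : 2 * (α : ℂ) = ((2 * α : ℝ) : ℂ) := by push_cast; ring
  have e2 : (4 * (α : ℂ) - 3) / 2 = (((4 * α - 3) / 2 : ℝ) : ℂ) := by push_cast; ring
  have e3 : (4 * (α : ℂ) - 1) / 2 = (((4 * α - 1) / 2 : ℝ) : ℂ) := by push_cast; ring
  rw [e1, e2, e3, Complex.zero_le_real, Complex.zero_le_real, Complex.zero_le_real]
  constructor
  · rintro ⟨-, h, -⟩
    linarith
  · intro h
    exact ⟨by linarith, by linarith, by linarith⟩

end ExtendibleMaps

theorem mainTheorem8 (A B : Type*) [Fintype A] [Fintype B] [DecidableEq A] [DecidableEq B]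
    [Nonempty A] [Nonempty B] :
    (∀ k : ℕ, IsGreatest (ExtendibleMaps.mapFidelities k (ExtendibleMaps.maximallyMixed A B))
      ((1 / 2 : ℝ) * (((k : ℝ) + 2) / ((k : ℝ) + 1)))) ∧
    (∀ k : ℕ, IsGreatest (ExtendibleMaps.stateFidelities k)
      ((1 / 2 : ℝ) * (((k : ℝ) + 2) / ((k : ℝ) + 1)))) ∧
    IsGreatest (ExtendibleMaps.mapFidelities 1 (ExtendibleMaps.maximallyMixed A B)) (3 / 4 : ℝ) ∧
    (∀ α : ℝ,
      spectrum ℂ (ExtendibleMaps.symM α) =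
        {2 * (α : ℂ), (4 * (α : ℂ) - 3) / 2, (4 * (α : ℂ) - 1) / 2} ∧
      (¬ (ExtendibleMaps.symM α).PosSemidef ↔ α < 3 / 4) ∧
      (¬ (ExtendibleMaps.symM α).PosSemidef ↔
        ∃ F ∈ ExtendibleMaps.mapFidelities 1 (ExtendibleMaps.maximallyMixed A B), α < F)) := by
  have h1 : IsGreatest
      (ExtendibleMaps.mapFidelities 1 (ExtendibleMaps.maximallyMixed A B)) (3 / 4 : ℝ) := by
    convert ExtendibleMaps.isGreatest_mapFidelities_maximallyMixed A B 1 using 1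
    norm_num
  have h2 : ∀ α : ℝ, ¬ (ExtendibleMaps.symM α).PosSemidef ↔ α < 3 / 4 := fun α => by
    rw [ExtendibleMaps.symM_posSemidef_iff, not_le]
  exact ⟨ExtendibleMaps.isGreatest_mapFidelities_maximallyMixed A B,
    ExtendibleMaps.isGreatest_stateFidelities, h1, fun α => ⟨ExtendibleMaps.spectrum_symM α, h2 α,
      -- As `3/4` is the least upper bound of the fidelities, lying below it means lying below one
      -- of them.
      (h2 α).trans (lt_isLUB_iff h1.isLUB)⟩⟩
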